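/- Let $\mathbb{F}_4$ be the field with four elements, $\zeta$ a generator of $\mathbb{F}_4$ over $\mathbb{F}_2$, $W=W(\mathbb{F}_4)$ its ring of Witt vectors with Frobenius lift $z\mapsto\overline{z}$, and denote the Teichmüller lift of $\zeta$ to $W$ by $\zeta$ as well. Let \[\mathcal{O}=W\langle T\rangle/(T^2+2,\ \zeta T-T\zeta^2)=\{x+yT\mid x,y\in W\},\qquad Tz=\overline{z}\,T\quad(z\in W),\] which is identified with the endomorphism ring of the formal group law over $\mathbb{F}_4$ of the curve $C_0:y^2+y=x^3$ in the coordinate $t=-x/y$ by letting $\zeta$ and $T$ correspond to the endomorphisms $\zeta(t)=\zeta t$ and $T(t)=t^2$; thus $\sum_n a_nT^n$ with Teichmüller digits $a_n$ corresponds to the formal sum of the series $a_nt^{2^n}$. Let $\mathbb{S}=\mathcal{O}^\times$ be the Morava stabilizer group of height $2$ at the prime $2$ with its profinite ($T$-adic) topology, $|x+yT|=x\overline{x}+2y\overline{y}$ the determinant, and \[F_{3/2}=\{\gamma\in\mathbb{S}\mid\gamma=1+xT^3\text{ for some }x\in\mathcal{O}\},\qquad F'_{3/2}=\{\gamma\in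 F_{3/2}\mid|\gamma|=1\}.\] Let $\omega\in\mathbb{S}$ be the element $\zeta$, let $\alpha=(1-2\zeta)/\sqrt{-7}\in\mathbb{S}$, where $\sqrt{-7}\in\mathbb{Z}_2$ is the square root with $\sqrt{-7}\equiv1$ mod $4$, let $i\in\mathbb{S}$ be the element corresponding to the automorphism of the formal group law induced by the automorphism $(x,y)\mapsto(x+1,\,y+x+\zeta)$ of $C_0$, and let $j=\omega i\omega^2$. Write $[g,h]=ghg^{-1}h^{-1}$. Then $F'_{3/2}$ is topologically generated by $\alpha^2$, $[i,\alpha]$ and $[j,\alpha]$: it is the closure in $\mathbb{S}$ of the subgroup generated by these three elements. -/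

import Mathlib

namespace Morava

noncomputable section

open scoped PowerSeries

/-- The field with four elements. -/
abbrev F4 : Type := GaloisField 2 2

/-- The ring of Witt vectors of the field with four elements. -/
abbrev W : Type := WittVector 2 F4

/-- The lift to `W` of the generator `a ↦ a ^ 2` of the Galois group of `F4`. -/
def conj : W →+* W := WittVector.frobenius

theorem F4.pow_four (a : F4) : a ^ 4 = a := by
  have : Fintype F4 := Fintype.ofFinite F4
  have h : Fintype.card F4 = 4 := by
    rw [← Nat.card_eq_fintype_card, GaloisField.card 2 2 (by norm_num)]; norm_num
  have := FiniteField.pow_card a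
  rwa [h] at this

theorem conj_conj (x : W) : conj (conj x) = x := by
  ext n
  simp only [conj, WittVector.coeff_frobenius_charP]
  rw [← pow_mul]
  exact F4.pow_four _

theorem conj_two : conj 2 = 2 := map_ofNat conj 2

/-- The Teichmüller lift `F4 → W`. -/
def teich : F4 →* W := WittVector.teichmuller 2

/-! ### The endomorphism ring `W⟨T⟩ / (T ^ 2 + 2, ζ T - T ζ ^ 2)` -/

/-- The ring `W⟨T⟩ / (T ^ 2 + 2, ζ T - T ζ ^ 2)`. It is free as a left `W`-module on `1, T`;
the element `⟨x, y⟩` stands for `x + y T`, and `T z = conj z T` for `z` in `W`. -/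
@[ext]
structure EndRing where
  /-- the coefficient of `1` -/
  x : W
  /-- the coefficient of `T` -/
  y : W

namespace EndRing

instance : Zero EndRing := ⟨⟨0, 0⟩⟩
instance : One EndRing := ⟨⟨1, 0⟩⟩
instance : Add EndRing := ⟨fun a b => ⟨a.x + b.x, a.y + b.y⟩⟩
instance : Neg EndRing := ⟨fun a => ⟨-a.x, -a.y⟩⟩
instance : Mul EndRing :=
  ⟨fun a b => ⟨a.x * b.x - 2 * (a.y * conj b.y), a.x * b.y + a.y * conj b.x⟩⟩

@[simp] theorem zero_x : (0 : EndRing).x = 0 := rfl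
@[simp] theorem zero_y : (0 : EndRing).y = 0 := rfl
@[simp] theorem one_x : (1 : EndRing).x = 1 := rfl
@[simp] theorem one_y : (1 : EndRing).y = 0 := rfl
@[simp] theorem add_x (a b : EndRing) : (a + b).x = a.x + b.x := rfl
@[simp] theorem add_y (a b : EndRing) : (a + b).y = a.y + b.y := rfl
@[simp] theorem neg_x (a : EndRing) : (-a).x = -a.x := rfl
@[simp] theorem neg_y (a : EndRing) : (-a).y = -a.y := rfl
@[simp] theorem mul_x (a b : EndRing) :
    (a * b).x = a.x * b.x - 2 * (a.y * conj b.y) := rfl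
@[simp] theorem mul_y (a b : EndRing) : (a * b).y = a.x * b.y + a.y * conj b.x := rfl

instance : Ring EndRing where
  add_assoc a b c := by ext1 <;> simp [add_assoc]
  zero_add a := by ext1 <;> simp
  add_zero a := by ext1 <;> simp
  add_comm a b := by ext1 <;> simp [add_comm]
  neg_add_cancel a := by ext1 <;> simp
  mul_assoc a b c := by ext1 <;> simp [conj_conj, conj_two] <;> ring
  one_mul a := by ext1 <;> simp
  mul_one a := by ext1 <;> simp
  left_distrib a b c := by ext1 <;> simp <;> ring
  right_distrib a b c := by ext1 <;> simp <;> ring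
  zero_mul a := by ext1 <;> simp
  mul_zero a := by ext1 <;> simp
  nsmul := nsmulRec
  zsmul := zsmulRec

/-- The inclusion of the coefficient ring. -/
def ofW : W →+* EndRing where
  toFun x := ⟨x, 0⟩
  map_one' := rfl
  map_zero' := rfl
  map_add' a b := by ext1 <;> simp
  map_mul' a b := by ext1 <;> simp

/-- The element `T`. -/
def T : EndRing := ⟨0, 1⟩

theorem T_mul_T : T * T = -2 := by
  have h : (-2 : EndRing) = ofW (-2) := by rw [map_neg, map_ofNat]
  rw [h]
  ext1 <;> simp [T, ofW]

theorem T_mul_ofW (z : W) : T * ofW z = ofW (conj z) * T := by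
  ext1 <;> simp [T, ofW]

theorem eq_add (a : EndRing) : a = ofW a.x + ofW a.y * T := by
  ext1 <;> simp [T, ofW]

/-- The ring automorphism with `T * a = twist a * T`. -/
def twist (a : EndRing) : EndRing := ⟨conj a.x, conj a.y⟩

theorem T_mul (a : EndRing) : T * a = twist a * T := by
  ext1 <;> simp [T, twist]

theorem exists_T_pow_mul (n : ℕ) (a : EndRing) : ∃ b, T ^ n * a = b * T ^ n := by
  induction n generalizing a with
  | zero => exact ⟨a, by simp⟩
  | succ n ih =>
    obtain ⟨b, hb⟩ := ih (twist a)
    exact ⟨b, by rw [pow_succ, mul_assoc, T_mul, ← mul_assoc, hb, mul_assoc]⟩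

/-- The two-sided ideal generated by `T ^ n`, as an additive subgroup. -/
def idealT (n : ℕ) : AddSubgroup EndRing where
  carrier := {a | ∃ b, a = b * T ^ n}
  zero_mem' := ⟨0, by simp⟩
  add_mem' := by
    rintro _ _ ⟨a, rfl⟩ ⟨b, rfl⟩
    exact ⟨a + b, by rw [add_mul]⟩
  neg_mem' := by
    rintro _ ⟨a, rfl⟩
    exact ⟨-a, by rw [neg_mul]⟩

theorem idealT_mono {m n : ℕ} (h : m ≤ n) : idealT n ≤ idealT m := by
  rintro _ ⟨b, rfl⟩
  exact ⟨b * T ^ (n - m), by rw [mul_assoc, ← pow_add, Nat.sub_add_cancel h]⟩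

theorem mul_mem_idealT_left (a : EndRing) {b : EndRing} {n : ℕ} (hb : b ∈ idealT n) :
    a * b ∈ idealT n := by
  obtain ⟨c, rfl⟩ := hb
  exact ⟨a * c, by rw [mul_assoc]⟩

theorem mul_mem_idealT_right (a : EndRing) {b : EndRing} {n : ℕ} (hb : b ∈ idealT n) :
    b * a ∈ idealT n := by
  obtain ⟨c, rfl⟩ := hb
  obtain ⟨d, hd⟩ := exists_T_pow_mul n a
  exact ⟨c * d, by rw [mul_assoc, hd, mul_assoc]⟩

theorem idealT_basis : RingSubgroupsBasis idealT where
  inter i j := ⟨max i j, le_inf (idealT_mono (le_max_left _ _)) (idealT_mono (le_max_right _ _))⟩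
  mul i := ⟨i, by
    rintro _ ⟨a, -, b, hb, rfl⟩
    exact mul_mem_idealT_left a hb⟩
  leftMul a i := ⟨i, fun _ hb => mul_mem_idealT_left a hb⟩
  rightMul a i := ⟨i, fun _ hb => mul_mem_idealT_right a hb⟩

/-- The `T`-adic topology. -/
instance : TopologicalSpace EndRing := idealT_basis.topology

instance : IsTopologicalRing EndRing :=
  idealT_basis.toRingFilterBasis.isTopologicalRing

/-- The determinant `|x + y T| = x * conj x + 2 * y * conj y`; its values are fixed by `conj`. -/
def det : EndRing →* W where
  toFun a := a.x * conj a.x + 2 * a.y * conj a.y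
  map_one' := by simp
  map_mul' a b := by simp [conj_conj, conj_two]; ring

theorem det_apply (a : EndRing) : det a = a.x * conj a.x + 2 * a.y * conj a.y := rfl

theorem isUnit_of_coeff_ne_zero (a : EndRing) (h : a.x.coeff 0 ≠ 0) : IsUnit a := by
  have hx : IsUnit a.x := WittVector.isUnit_of_coeff_zero_ne_zero _ h
  have hdet : IsUnit (det a) := by
    apply WittVector.isUnit_of_coeff_zero_ne_zero
    have h2 : (2 : W).coeff 0 = 0 := by
      have := WittVector.coeff_p_zero (p := 2) (R := F4)
      exact_mod_cast this
    have : (det a).coeff 0 = a.x.coeff 0 * a.x.coeff 0 ^ 2 := by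
      rw [det_apply, WittVector.add_coeff_zero, WittVector.mul_coeff_zero,
        WittVector.mul_coeff_zero, WittVector.mul_coeff_zero, h2, conj,
        WittVector.coeff_frobenius_charP]
      ring
    rw [this]
    exact mul_ne_zero h (pow_ne_zero _ h)
  obtain ⟨u, hu⟩ := hdet
  have hconj : conj (det a) = det a := by
    simp [det_apply, conj_conj, conj_two]; ring
  have hv : (det a) * (↑u⁻¹ : W) = 1 := by rw [← hu]; simp
  have hv' : conj (↑u⁻¹ : W) = (↑u⁻¹ : W) := by
    have h1 : det a * conj (↑u⁻¹ : W) = 1 := by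
      have := congrArg conj hv
      rwa [map_mul, map_one, hconj] at this
    calc conj (↑u⁻¹ : W) = (det a * (↑u⁻¹ : W)) * conj (↑u⁻¹ : W) := by rw [hv, one_mul]
      _ = (det a * conj (↑u⁻¹ : W)) * (↑u⁻¹ : W) := by ring
      _ = _ := by rw [h1, one_mul]
  rw [det_apply] at hv
  refine ⟨⟨a, ⟨conj a.x * ↑u⁻¹, -a.y * ↑u⁻¹⟩, ?_, ?_⟩, rfl⟩
  · ext1
    · simp only [mul_x, one_x, map_mul, map_neg, hv']
      linear_combination hv
    · simp only [mul_y, one_y, map_mul, conj_conj, hv']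
      ring
  · ext1
    · simp only [mul_x, one_x]
      linear_combination hv
    · simp only [mul_y, one_y]
      ring

end EndRing

open EndRing

/-- The (restricted) Morava stabilizer group of height `2` at the prime `2`, with its profinite
topology (the unit topology of the `T`-adic topology). -/
abbrev S : Type := EndRingˣ

/-- The subgroup `F_{n/2}` of `S` of elements of the form `1 + x T ^ n`. -/
def F (n : ℕ) : Subgroup S where
  carrier := {g | ∃ x : EndRing, (g : EndRing) = 1 + x * T ^ n}
  one_mem' := ⟨0, by simp⟩
  mul_mem' := by
    rintro g h ⟨x, hx⟩ ⟨y, hy⟩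
    refine ⟨x + (g : EndRing) * y, ?_⟩
    rw [Units.val_mul, hy, mul_add, mul_one, add_mul, ← mul_assoc, ← add_assoc, ← hx]
  inv_mem' := by
    rintro g ⟨x, hx⟩
    refine ⟨-((↑g⁻¹ : EndRing) * x), ?_⟩
    have h : (↑g⁻¹ : EndRing) * g = 1 := g.inv_mul
    rw [hx, mul_add, mul_one, ← mul_assoc] at h
    rw [neg_mul, ← h]
    abel

/-- The subgroup `F'_{3/2}` of elements of `F_{3/2}` of determinant `1`. -/
def F32' : Subgroup S := F 3 ⊓ (det.comp (Units.coeHom EndRing)).ker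

theorem mem_F32' (g : S) :
    g ∈ F32' ↔ (∃ x : EndRing, (g : EndRing) = 1 + x * T ^ 3) ∧ det (g : EndRing) = 1 :=
  Iff.rfl

/-! ### The elements `α` and `ω` -/

theorem exists_sqrt : ∃ r : ℤ_[2], r ^ 2 = -7 ∧ (4 : ℤ_[2]) ∣ r - 1 := by
  -- `r = 1 + 4 s` is a root of `X ^ 2 + 7` when `2 * s ^ 2 + s + 1 = 0`
  let p : Polynomial ℤ_[2] := 2 * Polynomial.X ^ 2 + Polynomial.X + 1
  have hn : ‖p.aeval (1 : ℤ_[2])‖ < ‖p.derivative.aeval (1 : ℤ_[2])‖ ^ 2 := by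
    have h1 : p.aeval (1 : ℤ_[2]) = ((4 : ℤ) : ℤ_[2]) := by
      simp [p]; norm_num
    have h2 : p.derivative.aeval (1 : ℤ_[2]) = ((5 : ℤ) : ℤ_[2]) := by
      simp [p]; norm_num
    have h3 : ‖((4 : ℤ) : ℤ_[2])‖ < 1 := by
      rw [PadicInt.norm_int_lt_one_iff_dvd]; norm_num
    have h4 : ‖((5 : ℤ) : ℤ_[2])‖ = 1 := by
      rw [PadicInt.norm_intCast_eq_one_iff]; norm_num
    rw [h1, h2, h4]; simpa using h3
  obtain ⟨s, hs, -⟩ := hensels_lemma hn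
  have hs' : 2 * s ^ 2 + s + 1 = 0 := by simpa [p] using hs
  exact ⟨1 + 4 * s, by linear_combination 8 * hs', ⟨s, by ring⟩⟩

/-- The square root of `-7` in `ℤ_[2]` that is congruent to `1` modulo `4`. -/
def sqrtNegSeven : ℤ_[2] := Classical.choose exists_sqrt

theorem sqrtNegSeven_spec : sqrtNegSeven ^ 2 = -7 ∧ (4 : ℤ_[2]) ∣ sqrtNegSeven - 1 :=
  Classical.choose_spec exists_sqrt

theorem isUnit_sqrtNegSeven : IsUnit sqrtNegSeven := by
  have h7 : IsUnit (((-7 : ℤ)) : ℤ_[2]) := by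
    rw [PadicInt.isUnit_iff, PadicInt.norm_intCast_eq_one_iff]; norm_num
  have h := sqrtNegSeven_spec.1
  refine isUnit_of_mul_isUnit_left (y := sqrtNegSeven) ?_
  rw [← pow_two, h]
  exact_mod_cast h7

/-- The embedding of the `2`-adic integers, the Witt vectors of the prime field, into `W`. -/
def ofPadicInt : ℤ_[2] →+* W :=
  (WittVector.map (algebraMap (ZMod 2) F4)).comp (WittVector.equiv 2).symm.toRingHom

theorem isUnit_one_sub_two_mul (ζ : F4) : IsUnit (1 - 2 * teich ζ) := by
  have h : (1 : F4) = (1 - 2 * teich ζ : W).coeff 0 := by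
    have h2 : WittVector.constantCoeff (2 : W) = 0 := by
      rw [map_ofNat]; exact CharTwo.two_eq_zero
    change 1 = WittVector.constantCoeff (1 - 2 * teich ζ : W)
    rw [map_sub, map_one, map_mul, h2, zero_mul, sub_zero]
  exact WittVector.isUnit_of_coeff_zero_ne_zero _ (h ▸ one_ne_zero)

/-- The element `α = (1 - 2 ζ) / √-7` of `S`. -/
def alpha (ζ : F4) : S :=
  Units.map (ofW : W →* EndRing)
    ((isUnit_one_sub_two_mul ζ).unit *
      (Units.map (ofPadicInt : ℤ_[2] →* W) isUnit_sqrtNegSeven.unit)⁻¹)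

/-- The element `ω` of `S`: the Teichmüller lift of `ζ`. -/
def omega (ζ : F4ˣ) : S :=
  Units.map (ofW : W →* EndRing) (Units.map teich ζ)

/-! ### The formal group law of the curve `y ^ 2 + y = x ^ 3` over `F4`

In the coordinates `t = -x / y`, `w = -1 / y` around the base point the curve reads
`w = t ^ 3 + w ^ 2`. -/

open Classical in
/-- The expansion `w(t) = ∑ n, t ^ (3 * 2 ^ n)` of `w = -1 / y` in the coordinate `t = -x / y`. -/
def wSeries : F4⟦X⟧ := PowerSeries.mk fun m => if ∃ n : ℕ, m = 3 * 2 ^ n then 1 else 0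

theorem wSeries_eq : wSeries = PowerSeries.X ^ 3 + wSeries ^ 2 := by
  have h2 : wSeries ^ 2 = PowerSeries.expand 2 two_ne_zero wSeries := by
    have hm : PowerSeries.map (frobenius F4 2) wSeries = wSeries := by
      ext m
      simp only [wSeries, PowerSeries.coeff_map, PowerSeries.coeff_mk]
      split_ifs <;> simp
    have h := MvPowerSeries.map_frobenius_expand (σ := Unit) 2 two_ne_zero (f := wSeries)
    rw [MvPowerSeries.map_expand] at h
    exact h.symm.trans (congrArg (PowerSeries.expand 2 two_ne_zero) hm)
  rw [h2]
  ext m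
  rw [map_add, PowerSeries.coeff_expand, PowerSeries.coeff_X_pow]
  simp only [wSeries, PowerSeries.coeff_mk]
  by_cases h3 : m = 3
  · subst h3
    simp
  · rw [if_neg h3, zero_add]
    by_cases hd : 2 ∣ m
    · rw [if_pos hd]
      obtain ⟨q, rfl⟩ := hd
      rw [Nat.mul_div_cancel_left _ two_pos]
      congr 1
      apply propext
      constructor
      · rintro ⟨n, hn⟩
        cases n with
        | zero => omega
        | succ n => exact ⟨n, by rw [pow_succ] at hn; omega⟩
      · rintro ⟨n, hn⟩
        exact ⟨n + 1, by rw [pow_succ]; omega⟩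
    · rw [if_neg hd, if_neg]
      rintro ⟨n, hn⟩
      cases n with
      | zero => omega
      | succ n => exact hd ⟨3 * 2 ^ n, by rw [hn, pow_succ]; ring⟩

/-- The slope `(w(t₀) - w(t₁)) / (t₀ - t₁)` of the line through the points with coordinates `t₀`
and `t₁`; the coefficient of `t₀ ^ a * t₁ ^ b` is the coefficient of `t ^ (a + b + 1)` in `w(t)`. -/
def slope : MvPowerSeries (Fin 2) F4 := fun e => PowerSeries.coeff (e 0 + e 1 + 1) wSeries

/-- The coordinate of the third point of intersection of that line with the curve. -/
def thirdPoint : MvPowerSeries (Fin 2) F4 :=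
  -MvPowerSeries.X 0 - MvPowerSeries.X 1 - slope ^ 2

/-- The formal group law of the curve in the coordinate `t`: the coordinate of the inverse of the
third point, where the inverse of the point with coordinate `t` has coordinate `t / (w(t) - 1)`. -/
def formalGroupLaw : MvPowerSeries (Fin 2) F4 :=
  thirdPoint * (PowerSeries.subst thirdPoint wSeries - 1)⁻¹

/-- The formal sum of two power series without constant term. -/
def formalAdd (f g : F4⟦X⟧) : F4⟦X⟧ := MvPowerSeries.subst ![f, g] formalGroupLaw

/-! ### Elements of `EndRing` from power series

An element `∑ aₙ T ^ n` of `EndRing`, with Teichmüller digits `aₙ`, corresponds to the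
endomorphism of the formal group law given by the formal sum of the series `aₙ t ^ (2 ^ n)`;
`ζ` corresponds to `ζ t` and `T` to `t ^ 2`. -/

/-- The `n`-th partial formal sum `∑ k < n, aₖ t ^ (2 ^ k)` of the expansion of `f`. As the formal
sum of two series agrees with their sum up to mixed terms, the digit `aₙ` has to be the coefficient
of `t ^ (2 ^ n)` in the difference of `f` and the `n`-th partial sum. -/
def partialFormalSum (f : F4⟦X⟧) : ℕ → F4⟦X⟧
  | 0 => 0
  | n + 1 => formalAdd (partialFormalSum f n)
      (PowerSeries.monomial (2 ^ n) (PowerSeries.coeff (2 ^ n) (f - partialFormalSum f n)))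

/-- The digits `aₙ` of an endomorphism `f = ∑ aₙ t ^ (2 ^ n)` (formal sum). -/
def digit (f : F4⟦X⟧) (n : ℕ) : F4 := PowerSeries.coeff (2 ^ n) (f - partialFormalSum f n)

theorem exists_wittSum (a : ℕ → F4) :
    ∃ z : W, ∀ n : ℕ, (2 : W) ^ n ∣ z - ∑ k ∈ Finset.range n, teich (a k) * (-2) ^ k := by
  have h := (WittVector.isAdicCompleteIdealSpanP (p := 2) (k := F4)).prec'
    (fun n => ∑ k ∈ Finset.range n, teich (a k) * (-2 : W) ^ k) ?_
  · obtain ⟨z, hz⟩ := h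
    refine ⟨z, fun n => ?_⟩
    have := (hz n).symm
    rw [SModEq.sub_mem, Ideal.span_singleton_pow, smul_eq_mul, Ideal.mul_top,
      Ideal.mem_span_singleton] at this
    exact_mod_cast this
  · intro m n hmn
    apply SModEq.symm
    rw [SModEq.sub_mem, Ideal.span_singleton_pow, smul_eq_mul, Ideal.mul_top,
      Ideal.mem_span_singleton, ← Finset.sum_range_add_sum_Ico _ hmn, add_sub_cancel_left]
    refine Finset.dvd_sum fun k hk => Dvd.dvd.mul_left ?_ _
    have hk' := (Finset.mem_Ico.mp hk).1
    rw [neg_pow]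
    exact Dvd.dvd.mul_left (by exact_mod_cast pow_dvd_pow (2 : W) hk') _

/-- The convergent sum `∑ k, aₖ * (-2) ^ k` in `W`, with Teichmüller representatives. -/
def wittSum (a : ℕ → F4) : W := Classical.choose (exists_wittSum a)

theorem wittSum_spec (a : ℕ → F4) (n : ℕ) :
    (2 : W) ^ n ∣ wittSum a - ∑ k ∈ Finset.range n, teich (a k) * (-2) ^ k :=
  Classical.choose_spec (exists_wittSum a) n

/-- The element `∑ aₙ T ^ n` of `EndRing`, sorted into even and odd powers by `T ^ 2 = -2`. -/
def ofDigits (a : ℕ → F4) : EndRing :=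
  ⟨wittSum fun k => a (2 * k), wittSum fun k => a (2 * k + 1)⟩

/-- The element of `EndRing` that corresponds to an endomorphism of the formal group law. -/
def ofSeries (f : F4⟦X⟧) : EndRing := ofDigits (digit f)

/-! ### The elements `i` and `j` -/

/-- The expansion in `t` of the automorphism `(x, y) ↦ (x + 1, y + x + ζ)` of the curve:
with `x = t / w` and `y = -1 / w`, the series `-(x + 1) / (y + x + ζ)`. -/
def iSeries (ζ : F4) : F4⟦X⟧ :=
  (PowerSeries.X + wSeries) * (1 - PowerSeries.X - PowerSeries.C ζ * wSeries)⁻¹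

theorem isUnit_ofSeries (f : F4⟦X⟧) (h : PowerSeries.coeff 1 f ≠ 0) : IsUnit (ofSeries f) := by
  apply isUnit_of_coeff_ne_zero
  have h0 := wittSum_spec (fun k => digit f (2 * k)) 1
  obtain ⟨c, hc⟩ := h0
  have h2 : WittVector.constantCoeff (2 : W) = 0 := by
    rw [map_ofNat]; exact CharTwo.two_eq_zero
  have h3 := congrArg WittVector.constantCoeff hc
  simp only [pow_one, Finset.range_one, Finset.sum_singleton, pow_zero, mul_one, map_sub, map_mul,
    h2, zero_mul, sub_eq_zero] at h3
  have h4 : WittVector.constantCoeff (teich (digit f (2 * 0))) = digit f 0 :=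
    WittVector.teichmuller_coeff_zero 2 _
  rw [h4] at h3
  change WittVector.constantCoeff (wittSum fun k => digit f (2 * k)) ≠ 0
  rw [h3]
  simpa [digit, partialFormalSum] using h

theorem coeff_one_iSeries (ζ : F4) : PowerSeries.coeff 1 (iSeries ζ) ≠ 0 := by
  have hw0 : PowerSeries.constantCoeff wSeries = 0 := by
    rw [← PowerSeries.coeff_zero_eq_constantCoeff_apply, wSeries, PowerSeries.coeff_mk, if_neg]
    rintro ⟨n, hn⟩
    have := Nat.two_pow_pos n
    omega
  have hw1 : PowerSeries.coeff 1 wSeries = 0 := by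
    rw [wSeries, PowerSeries.coeff_mk, if_neg]
    rintro ⟨n, hn⟩
    omega
  rw [iSeries, PowerSeries.coeff_mul]
  simp [Finset.Nat.antidiagonal_succ, hw0, hw1]

/-- The element `i` of `S`. -/
def elemI (ζ : F4) : S := (isUnit_ofSeries (iSeries ζ) (coeff_one_iSeries ζ)).unit

/-- The element `j = ω i ω ^ 2` of `S`. -/
def elemJ (ζ : F4ˣ) : S := omega ζ * elemI ζ * omega ζ ^ 2

end

end Morava

namespace Morava

noncomputable section

open EndRing
open scoped PowerSeries commutatorElement

/-! ### The residue field of `EndRing` -/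

/-! The proof is successive approximation along the filtration `F n`. Modulo `F (n + 1)`, an element
of `F n` is determined by its leading coefficient in `F4` (`HasLead`), and for `n ≥ 1` leading
coefficients add under multiplication (`HasLead.mul`). Since `T ^ 2 = -2`, squaring moves an element
of level `n ≥ 3` to level `n + 2` and keeps its leading coefficient (`HasLead.sq`). At even levels,
determinant `1` forces the leading coefficient into the prime field (`HasLead.eq_zero_or_one`).
Hence a subgroup of `F32'` is dense as soon as it realises every coefficient at level 3 and the
coefficient `1` at level 4 (`topologicalClosure_eq_F32'`).

The generators do exactly this. The square of `α` is `1 + 4 (1 - 2 ζ) / (-7)` with `4 = T ^ 4`, so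
it has coefficient `1` at level 4. If `g = x + y T` reduces to `1`, then `⁅g, α⁆` has the residue of
`y` as its coefficient at level 3 (`hasLead_commutator_alpha`). This residue is `1` for `i` and `ζ ^
2` for `j`, and these two span `F4` over the prime field. The value for `i` is read off from its
series `t + t ^ 2 + ⋯`, because formal addition differs from addition only from degree 3 on
(`coeff_formalAdd`). -/

theorem coeff_zero_two : (2 : W).coeff 0 = 0 := by
  have := WittVector.coeff_p_zero (p := 2) (R := F4)
  exact_mod_cast this

theorem constantCoeff_two : WittVector.constantCoeff (2 : W) = 0 := coeff_zero_two

theorem two_dvd_iff (x : W) : 2 ∣ x ↔ WittVector.constantCoeff x = 0 := by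
  rw [← Ideal.mem_span_singleton]
  have := WittVector.mem_span_p_iff_coeff_zero_eq_zero (p := 2) (k := F4) x
  rwa [Nat.cast_ofNat] at this

theorem constantCoeff_conj (x : W) :
    WittVector.constantCoeff (conj x) = WittVector.constantCoeff x ^ 2 :=
  WittVector.coeff_frobenius_charP 2 x 0

theorem constantCoeff_teich (a : F4) : WittVector.constantCoeff (teich a) = a :=
  WittVector.teichmuller_coeff_zero 2 a

theorem two_ne_zero_W : (2 : W) ≠ 0 := by
  have := WittVector.p_nonzero 2 F4
  exact_mod_cast this

theorem eq_zero_of_forall_two_pow_dvd {x : W} (h : ∀ n : ℕ, (2 : W) ^ n ∣ x) : x = 0 := by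
  refine (WittVector.isAdicCompleteIdealSpanP (p := 2) (k := F4)).toIsHausdorff.haus x fun n => ?_
  rw [SModEq.zero, Ideal.span_singleton_pow, smul_eq_mul, Ideal.mul_top,
    Ideal.mem_span_singleton]
  exact_mod_cast h n

namespace EndRing

/-- The reduction of `EndRing` modulo the maximal ideal generated by `T`. -/
def residue : EndRing →+* F4 where
  toFun a := WittVector.constantCoeff a.x
  map_one' := by simp
  map_zero' := by simp
  map_add' a b := by rw [add_x, map_add]
  map_mul' a b := by
    rw [mul_x, map_sub, map_mul, map_mul, constantCoeff_two, zero_mul, sub_zero]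

theorem residue_apply (a : EndRing) : residue a = WittVector.constantCoeff a.x := rfl

@[simp] theorem residue_T : residue T = 0 := by simp [residue_apply, T]

@[simp] theorem residue_ofW (z : W) : residue (ofW z) = WittVector.constantCoeff z := rfl

theorem mem_idealT_one {a : EndRing} (h : residue a = 0) : a ∈ idealT 1 := by
  obtain ⟨c, hc⟩ := (two_dvd_iff _).2 h
  -- With `a.x = 2 c` and `T ^ 2 = -2`, the constant part is `2 c = -c T * T`.
  refine ⟨ofW a.y - ofW c * T, ?_⟩
  ext1 <;> simp [T, ofW, hc, sub_eq_add_neg]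

theorem T_pow_two_mul (k : ℕ) : T ^ (2 * k) = ofW ((-2) ^ k) := by
  rw [pow_mul, sq, T_mul_T, map_pow, map_neg, map_ofNat]

theorem mul_ofW (a : EndRing) (z : W) : a * ofW z = ⟨a.x * z, a.y * conj z⟩ := by
  ext1 <;> simp [ofW]

theorem two_pow_dvd_of_mem_idealT {a : EndRing} {k : ℕ} (h : a ∈ idealT (2 * k)) :
    2 ^ k ∣ a.x ∧ 2 ^ k ∣ a.y := by
  obtain ⟨b, rfl⟩ := h
  rw [T_pow_two_mul, mul_ofW]
  have h2 : (2 : W) ^ k ∣ (-2) ^ k := by rw [neg_pow]; exact Dvd.intro_left _ rfl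
  refine ⟨h2.mul_left _, ?_⟩
  simp only [map_pow, map_neg, conj_two]
  exact h2.mul_left _

/-- The `T`-adic continuity of the determinant, needed to see that determinant `1` is a closed
condition. -/
theorem two_pow_dvd_det_sub {a b : EndRing} {k : ℕ} (h : a - b ∈ idealT (2 * k)) :
    2 ^ k ∣ det a - det b := by
  obtain ⟨⟨c, hc⟩, d, hd⟩ := two_pow_dvd_of_mem_idealT h
  simp only [sub_eq_add_neg, add_x, add_y, neg_x, neg_y] at hc hd
  have hx : a.x = b.x + 2 ^ k * c := by linear_combination hc
  have hy : a.y = b.y + 2 ^ k * d := by linear_combination hd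
  simp only [det_apply, hx, hy, map_add, map_mul, map_pow, conj_two]
  exact ⟨b.x * conj c + c * conj b.x + 2 ^ k * c * conj c
    + 2 * (b.y * conj d + d * conj b.y + 2 ^ k * d * conj d), by ring⟩

theorem mem_closure_iff (s : Set EndRing) (a : EndRing) :
    a ∈ closure s ↔ ∀ n, ∃ b ∈ s, b - a ∈ idealT n := by
  rw [mem_closure_iff_nhds_basis (idealT_basis.hasBasis_nhds a)]
  simp

end EndRing

/-! ### The filtration `F n` and closures in the unit topology -/

theorem F_mono {m n : ℕ} (h : m ≤ n) : F n ≤ F m := by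
  rintro g ⟨x, hx⟩
  exact ⟨x * T ^ (n - m), by rw [hx, mul_assoc, ← pow_add, Nat.sub_add_cancel h]⟩

theorem mem_F_iff {n : ℕ} {g : S} : g ∈ F n ↔ (g : EndRing) - 1 ∈ idealT n := by
  constructor
  · rintro ⟨x, hx⟩
    exact ⟨x, by rw [hx]; abel⟩
  · rintro ⟨x, hx⟩
    exact ⟨x, by rw [← hx]; abel⟩

/-- The unit topology also controls the inverse; as `F n` is a subgroup, `g⁻¹` is as close to `1` as
`g`. -/
theorem exists_F_subset_of_mem_nhds_one {U : Set S} (hU : U ∈ nhds (1 : S)) :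
    ∃ n, (F n : Set S) ⊆ U := by
  rw [Units.isEmbedding_embedProduct.nhds_eq_comap, Filter.mem_comap] at hU
  obtain ⟨V, hV, hVU⟩ := hU
  obtain ⟨U₁, hU₁, U₂, hU₂, hUV⟩ := mem_nhds_prod_iff.1 hV
  obtain ⟨m, -, hm⟩ := (idealT_basis.hasBasis_nhds _).mem_iff.1 hU₁
  obtain ⟨n, -, hn⟩ := (idealT_basis.hasBasis_nhds _).mem_iff.1
    (MulOpposite.continuous_op.continuousAt.preimage_mem_nhds (x := (1 : EndRing)) hU₂)
  refine ⟨max m n, fun g hg => hVU (hUV ⟨hm ?_, hn (a := (↑g⁻¹ : EndRing)) ?_⟩)⟩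
  · simpa using mem_F_iff.1 (F_mono (le_max_left m n) hg)
  · simpa using mem_F_iff.1 (F_mono (le_max_right m n) (inv_mem hg))

theorem mem_closure_of_forall_mem_F {H : Subgroup S} {g : S}
    (h : ∀ n, ∃ k ∈ H, k * g ∈ F n) : g ∈ H.topologicalClosure := by
  change g ∈ closure (H : Set S)
  refine mem_closure_iff_nhds.2 fun U hU => ?_
  -- This map sends `k * g` to `k⁻¹`, so `k * g` close to `1` gives `k⁻¹` close to `g`.
  have hU' : (fun u => g * u⁻¹) ⁻¹' U ∈ nhds (1 : S) :=
    (show Continuous fun u : S => g * u⁻¹ by fun_prop).continuousAt.preimage_mem_nhds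
      (by simpa using hU)
  obtain ⟨n, hn⟩ := exists_F_subset_of_mem_nhds_one hU'
  obtain ⟨k, hk, hkg⟩ := h n
  refine ⟨k⁻¹, ?_, inv_mem hk⟩
  simpa using hn hkg

theorem isClosed_F32' : IsClosed (F32' : Set S) := by
  refine isClosed_of_closure_subset fun g hg => ?_
  have h := (EndRing.mem_closure_iff _ _).1
    (image_closure_subset_closure_image Units.continuous_val (Set.mem_image_of_mem _ hg))
  refine ⟨?_, ?_⟩
  · obtain ⟨_, ⟨k, hk, rfl⟩, hkg⟩ := h 3
    refine mem_F_iff.2 ?_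
    have := sub_mem (mem_F_iff.1 hk.1) hkg
    simpa using this
  -- Approximating elements have determinant `1`, so the determinant of the limit is `1` modulo
  -- every power of `2`, and `W` is separated.
  · refine sub_eq_zero.1 (eq_zero_of_forall_two_pow_dvd fun n => ?_)
    obtain ⟨_, ⟨k, hk, rfl⟩, hkg⟩ := h (2 * n)
    have h1 := two_pow_dvd_det_sub hkg
    rw [((mem_F32' k).1 hk).2, dvd_sub_comm] at h1
    exact h1

/-! ### Leading coefficients in the filtration of `S` -/

/-- The element `g` is congruent to `1 + a T ^ n` modulo `T ^ (n + 1)`. -/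
def HasLead (n : ℕ) (a : F4) (g : S) : Prop :=
  ∃ b : EndRing, (g : EndRing) = 1 + b * T ^ n ∧ residue b = a

theorem exists_hasLead {n : ℕ} {g : S} (hg : g ∈ F n) : ∃ a, HasLead n a g := by
  obtain ⟨b, hb⟩ := hg
  exact ⟨_, b, hb, rfl⟩

theorem HasLead.mul {n : ℕ} (hn : n ≠ 0) {a b : F4} {g h : S} (hg : HasLead n a g)
    (hh : HasLead n b h) : HasLead n (a + b) (g * h) := by
  obtain ⟨c, hc, rfl⟩ := hg
  obtain ⟨d, hd, rfl⟩ := hh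
  obtain ⟨e, he⟩ := exists_T_pow_mul n d
  refine ⟨c + d + c * e * T ^ n, ?_, by simp [hn]⟩
  rw [Units.val_mul, hc, hd, mul_assoc c e, ← he]
  noncomm_ring

/-- In `(1 + b T ^ n) ^ 2` the cross term is `2 b T ^ n = -b T ^ (n + 2)`, and the square term lies
in level `2 n`, which exceeds `n + 2` exactly because `n ≥ 3`. The sign disappears in characteristic
2. -/
theorem HasLead.sq {n : ℕ} (hn : 3 ≤ n) {a : F4} {g : S} (hg : HasLead n a g) :
    HasLead (n + 2) a (g ^ 2) := by
  obtain ⟨b, hb, rfl⟩ := hg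
  obtain ⟨e, he⟩ := exists_T_pow_mul n b
  refine ⟨-b + b * e * T ^ (n - 2), ?_, ?_⟩
  · have h1 : b * e * T ^ (n - 2) * T ^ (n + 2) = b * T ^ n * (b * T ^ n) := by
      rw [mul_assoc (b * e), ← pow_add, show n - 2 + (n + 2) = n + n by omega, pow_add,
        ← mul_assoc, mul_assoc b e, ← he]
      noncomm_ring
    have h2 : -b * T ^ (n + 2) = 2 * (b * T ^ n) := by
      rw [pow_add, pow_two, T_mul_T]
      noncomm_ring
    rw [add_mul, h1, h2, Units.val_pow_eq_pow_val, hb]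
    noncomm_ring
  · have : n - 2 ≠ 0 := by omega
    simp [this, CharTwo.neg_eq]

theorem HasLead.mem_F_succ {n : ℕ} {g : S} (hg : HasLead n 0 g) : g ∈ F (n + 1) := by
  obtain ⟨b, hb, h0⟩ := hg
  obtain ⟨c, rfl⟩ := mem_idealT_one h0
  exact ⟨c, by rw [hb, mul_assoc, ← pow_add, Nat.add_comm 1]⟩

theorem HasLead.mem_F {n : ℕ} {a : F4} {g : S} (hg : HasLead n a g) : g ∈ F n := by
  obtain ⟨b, hb, -⟩ := hg
  exact ⟨b, hb⟩

/-- As `T ^ (2 * m) = (-2) ^ m` is central, expanding the determinant and cancelling `(-2) ^ m`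
leaves a trace which vanishes modulo `2`: `a + a ^ 2 = 0`. -/
theorem HasLead.eq_zero_or_one {m : ℕ} (hm : 1 ≤ m) {a : F4} {g : S} (hg : HasLead (2 * m) a g)
    (hdet : det (g : EndRing) = 1) : a = 0 ∨ a = 1 := by
  obtain ⟨b, hb, rfl⟩ := hg
  rw [T_pow_two_mul, mul_ofW] at hb
  have h2 : ((-2) ^ m : W) ≠ 0 := pow_ne_zero _ (neg_ne_zero.2 two_ne_zero_W)
  have hb' : (g : EndRing) = ⟨1 + b.x * (-2) ^ m, b.y * (-2) ^ m⟩ := by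
    rw [hb]; ext1 <;> simp [conj_two]
  rw [hb', det_apply] at hdet
  simp only [map_add, map_one, map_mul, map_pow, map_neg, conj_two] at hdet
  have h3 : b.x + conj b.x + (-2) ^ m * (b.x * conj b.x + 2 * b.y * conj b.y) = 0 := by
    refine mul_left_cancel₀ h2 ?_
    linear_combination hdet
  have h4 := congrArg WittVector.constantCoeff h3
  have hm' : m ≠ 0 := by omega
  simp only [map_add, map_mul, map_pow, map_neg, constantCoeff_two, constantCoeff_conj, neg_zero,
    zero_pow hm', zero_mul, add_zero, map_zero] at h4
  rw [residue_apply]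
  have h5 : WittVector.constantCoeff b.x * (WittVector.constantCoeff b.x + 1) = 0 := by
    linear_combination h4
  rcases mul_eq_zero.1 h5 with h | h
  · exact Or.inl h
  · exact Or.inr (CharTwo.add_eq_zero.1 h)

/-- A subgroup of `F32'` is dense if it contains elements with the leading coefficients of all
elements of `F32'` in the first two steps of the filtration. -/
theorem topologicalClosure_eq_F32' {H : Subgroup S} (hH : H ≤ F32')
    (h3 : ∀ a, ∃ g ∈ H, HasLead 3 a g) (h4 : ∃ g ∈ H, HasLead 4 1 g) :
    H.topologicalClosure = F32' := by
  refine le_antisymm (H.topologicalClosure_minimal hH isClosed_F32') fun g hg => ?_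
  have hodd : ∀ m a, ∃ g ∈ H, HasLead (2 * m + 3) a g := by
    intro m a
    induction m with
    | zero => exact h3 a
    | succ m ih =>
      obtain ⟨g, hg, hl⟩ := ih
      exact ⟨g ^ 2, pow_mem hg 2, hl.sq (by omega)⟩
  have heven : ∀ m, ∃ g ∈ H, HasLead (2 * m + 4) 1 g := by
    intro m
    induction m with
    | zero => exact h4
    | succ m ih =>
      obtain ⟨g, hg, hl⟩ := ih
      exact ⟨g ^ 2, pow_mem hg 2, hl.sq (by omega)⟩
  -- The coset of `g` is pushed one level deeper at a time by cancelling the leading coefficient.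
  have step : ∀ n, ∃ k ∈ H, k * g ∈ F (n + 3) := by
    intro n
    induction n with
    | zero => exact ⟨1, one_mem _, by simpa using hg.1⟩
    | succ n ih =>
      obtain ⟨k, hk, hkg⟩ := ih
      obtain ⟨a, ha⟩ := exists_hasLead hkg
      have hdet : det ((k * g : S) : EndRing) = 1 := ((mem_F32' _).1 (mul_mem (hH hk) hg)).2
      have hex : ∃ l ∈ H, l * (k * g) ∈ F (n + 3 + 1) := by
        -- Multiplying by an element with the same coefficient cancels it, since `a + a = 0`.
        have key : ∀ l ∈ H, HasLead (n + 3) a l → ∃ l ∈ H, l * (k * g) ∈ F (n + 3 + 1) := by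
          intro l hl hla
          have := hla.mul (by omega) ha
          rw [CharTwo.add_self_eq_zero] at this
          exact ⟨l, hl, this.mem_F_succ⟩
        rcases Nat.even_or_odd' n with ⟨m, rfl | rfl⟩
        · obtain ⟨l, hl, hla⟩ := hodd m a
          exact key l hl hla
        · rcases (show HasLead (2 * (m + 2)) a (k * g) from ha).eq_zero_or_one (by omega) hdet
            with rfl | rfl
          · exact ⟨1, one_mem _, by simpa using ha.mem_F_succ⟩
          · obtain ⟨l, hl, hla⟩ := heven m
            exact key l hl hla
      obtain ⟨l, hl, hlk⟩ := hex
      exact ⟨l * k, mul_mem hl hk, by rw [mul_assoc]; convert hlk using 2⟩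
  refine mem_closure_of_forall_mem_F fun n => ?_
  obtain ⟨k, hk, hkg⟩ := step n
  exact ⟨k, hk, F_mono (by omega) hkg⟩

/-! ### The formal group law to low order -/

theorem coeff_wSeries_of_lt {n : ℕ} (hn : n < 3) : PowerSeries.coeff n wSeries = 0 := by
  rw [wSeries, PowerSeries.coeff_mk, if_neg]
  rintro ⟨k, hk⟩
  have := Nat.two_pow_pos k
  omega

theorem constantCoeff_wSeries : PowerSeries.constantCoeff wSeries = 0 := by
  rw [← PowerSeries.coeff_zero_eq_constantCoeff_apply, coeff_wSeries_of_lt (by norm_num)]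

/-- The divided difference lowers the order by one, and `w(t)` starts with `t ^ 3`. -/
theorem two_le_order_slope : 2 ≤ slope.order := by
  refine MvPowerSeries.nat_le_order (n := 2) fun d hd => coeff_wSeries_of_lt ?_
  rw [Finsupp.degree_eq_sum, Fin.sum_univ_two] at hd
  omega

theorem constantCoeff_slope : MvPowerSeries.constantCoeff slope = 0 :=
  coeff_wSeries_of_lt (n := 1) (by norm_num)

theorem constantCoeff_thirdPoint : MvPowerSeries.constantCoeff thirdPoint = 0 := by
  simp [thirdPoint, constantCoeff_slope]

theorem constantCoeff_subst_thirdPoint :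
    MvPowerSeries.constantCoeff (PowerSeries.subst thirdPoint wSeries) = 0 :=
  PowerSeries.constantCoeff_subst_eq_zero constantCoeff_thirdPoint _ constantCoeff_wSeries

theorem formalGroupLaw_mul :
    formalGroupLaw * (PowerSeries.subst thirdPoint wSeries - 1) = thirdPoint := by
  rw [formalGroupLaw, mul_assoc, MvPowerSeries.inv_mul_cancel, mul_one]
  rw [map_sub, constantCoeff_subst_thirdPoint]
  simp

/-- Formal addition agrees with addition up to terms of degree two. -/
theorem coeff_formalAdd {f g : F4⟦X⟧} (hf : PowerSeries.constantCoeff f = 0)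
    (hg : PowerSeries.constantCoeff g = 0) {n : ℕ} (hn : n ≤ 2) :
    PowerSeries.coeff n (formalAdd f g) = PowerSeries.coeff n (f + g) := by
  have hc : ∀ s, MvPowerSeries.constantCoeff (![f, g] s) = 0 := by
    intro s; fin_cases s
    · exact hf
    · exact hg
  have ha : MvPowerSeries.HasSubst ![f, g] := MvPowerSeries.hasSubst_of_constantCoeff_zero hc
  let φ : MvPowerSeries (Fin 2) F4 →ₐ[F4] F4⟦X⟧ := MvPowerSeries.substAlgHom ha
  have hφ : ∀ p, MvPowerSeries.constantCoeff p = 0 → PowerSeries.X ∣ φ p := by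
    intro p hp
    rw [PowerSeries.X_dvd_iff]
    change MvPowerSeries.constantCoeff (MvPowerSeries.substAlgHom ha p) = 0
    rw [MvPowerSeries.substAlgHom_apply]
    exact MvPowerSeries.constantCoeff_subst_eq_zero ha hc hp
  have hs : (PowerSeries.X : F4⟦X⟧) ^ 2 ∣ φ slope := by
    rw [PowerSeries.X_pow_dvd_iff]
    intro m hm
    refine PowerSeries.coeff_of_lt_order _ (lt_of_lt_of_le (Nat.cast_lt.2 hm) ?_)
    rw [PowerSeries.order_eq_order]
    change 2 ≤ MvPowerSeries.order (MvPowerSeries.substAlgHom ha slope)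
    rw [MvPowerSeries.substAlgHom_apply]
    refine le_trans ?_ (MvPowerSeries.le_order_subst ha slope)
    refine le_trans two_le_order_slope (ENat.self_le_mul_left _ ?_)
    refine (lt_of_lt_of_le zero_lt_one (le_iInf fun s => ?_)).ne'
    exact MvPowerSeries.one_le_order_iff_constCoeff_eq_zero.2 (hc s)
  -- The curve equation `w = t ^ 3 + w ^ 2` at the third point shows that `w` there has order at
  -- least 2.
  have hP : PowerSeries.subst thirdPoint wSeries
      = thirdPoint ^ 3 + PowerSeries.subst thirdPoint wSeries ^ 2 := by
    have h3 := PowerSeries.HasSubst.of_constantCoeff_zero constantCoeff_thirdPoint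
    conv_lhs => rw [wSeries_eq]
    rw [PowerSeries.subst_add h3, PowerSeries.subst_pow h3, PowerSeries.subst_pow h3,
      PowerSeries.subst_X h3]
  set P := PowerSeries.subst thirdPoint wSeries
  have hP2 : (PowerSeries.X : F4⟦X⟧) ^ 2 ∣ φ P := by
    rw [hP, map_add, map_pow, map_pow]
    exact dvd_add ((pow_dvd_pow _ (by norm_num)).trans
      (pow_dvd_pow_of_dvd (hφ _ constantCoeff_thirdPoint) 3))
      (pow_dvd_pow_of_dvd (hφ _ constantCoeff_subst_thirdPoint) 2)
  have hF : PowerSeries.X ∣ φ formalGroupLaw := by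
    refine hφ _ ?_
    rw [formalGroupLaw, map_mul, constantCoeff_thirdPoint, zero_mul]
  have hX0 : φ (MvPowerSeries.X 0) = f := MvPowerSeries.substAlgHom_X ha 0
  have hX1 : φ (MvPowerSeries.X 1) = g := MvPowerSeries.substAlgHom_X ha 1
  have hT : φ thirdPoint = -f - g - φ slope ^ 2 := by
    rw [thirdPoint, map_sub, map_sub, map_neg, map_pow, hX0, hX1]
  have h := congrArg φ formalGroupLaw_mul
  rw [map_mul, map_sub, map_one, hT] at h
  -- Clearing the denominator of the group law isolates an error whose two terms have order at least
  -- `1 + 2` and `2 * 2`.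
  have hdiff : φ formalGroupLaw - (f + g) = φ formalGroupLaw * φ P + φ slope ^ 2 := by
    linear_combination -h
  have hdvd : (PowerSeries.X : F4⟦X⟧) ^ 3 ∣ φ formalGroupLaw - (f + g) := by
    rw [hdiff]
    refine dvd_add ?_ ?_
    · rw [pow_succ']
      exact mul_dvd_mul hF hP2
    · exact (pow_dvd_pow _ (by norm_num)).trans ((pow_mul _ 2 2).dvd.trans
        (pow_dvd_pow_of_dvd hs 2))
  have := PowerSeries.X_pow_dvd_iff.1 hdvd n (by omega)
  rw [map_sub, sub_eq_zero] at this
  rw [← this, formalAdd, ← MvPowerSeries.substAlgHom_apply ha]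

/-- Since `w` has order 3, the series is `t / (1 - t)` up to degree 2, independently of `ζ`. -/
theorem coeff_iSeries (ζ : F4) :
    PowerSeries.coeff 1 (iSeries ζ) = 1 ∧ PowerSeries.coeff 2 (iSeries ζ) = 1 := by
  have h : iSeries ζ * (1 - PowerSeries.X - PowerSeries.C ζ * wSeries)
      = PowerSeries.X + wSeries := by
    rw [iSeries, mul_assoc, PowerSeries.inv_mul_cancel, mul_one]
    simp [constantCoeff_wSeries]
  have h0 := congrArg (PowerSeries.coeff 0) h
  have h1 := congrArg (PowerSeries.coeff 1) h
  have h2 := congrArg (PowerSeries.coeff 2) h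
  simp [PowerSeries.coeff_mul, Finset.Nat.antidiagonal_succ, coeff_wSeries_of_lt,
    PowerSeries.coeff_X, PowerSeries.coeff_one, constantCoeff_wSeries] at h0 h1 h2
  exact ⟨by linear_combination h0 + h1, by linear_combination h0 + h1 + h2⟩

theorem digit_zero_iSeries (ζ : F4) : digit (iSeries ζ) 0 = 1 := by
  rw [digit, partialFormalSum, sub_zero, pow_zero, (coeff_iSeries ζ).1]

theorem digit_one_iSeries (ζ : F4) : digit (iSeries ζ) 1 = 1 := by
  -- The first partial sum is the formal sum of `0` and a multiple of `t`, so it contributes nothing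
  -- in degree 2.
  have h : PowerSeries.coeff 2 (partialFormalSum (iSeries ζ) 1) = 0 := by
    rw [partialFormalSum, coeff_formalAdd _ _ le_rfl]
    · rw [map_add, partialFormalSum, map_zero, zero_add, pow_zero, PowerSeries.coeff_monomial,
        if_neg (by norm_num)]
    · rw [partialFormalSum, map_zero]
    · rw [← PowerSeries.coeff_zero_eq_constantCoeff_apply, pow_zero, PowerSeries.coeff_monomial,
        if_neg (by norm_num)]
  rw [digit, map_sub, pow_one, h, sub_zero, (coeff_iSeries ζ).2]

/-! ### The generators -/

theorem sq_add_self_add_one {ζ : F4ˣ} (hζ : Algebra.adjoin (ZMod 2) {(ζ : F4)} = ⊤) :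
    (ζ : F4) ^ 2 + ζ + 1 = 0 := by
  have h1 : (ζ : F4) ≠ 1 := by
    intro h
    rw [h, Algebra.adjoin_singleton_one, Subalgebra.bot_eq_top_iff_finrank_eq_one,
      GaloisField.finrank 2 two_ne_zero] at hζ
    omega
  have h : (ζ : F4) * (ζ - 1) * (ζ ^ 2 + ζ + 1) = 0 := by
    linear_combination F4.pow_four (ζ : F4)
  exact (mul_eq_zero.1 h).resolve_left (mul_ne_zero ζ.ne_zero (sub_ne_zero.2 h1))

/-- The four values are the combinations of the basis `1, ζ ^ 2` over the prime field; their linear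
factors multiply to `a ^ 4 - a`. -/
theorem F4.cases {ζ : F4} (hζ : ζ ^ 2 + ζ + 1 = 0) (a : F4) :
    a = 0 ∨ a = 1 ∨ a = ζ ^ 2 ∨ a = 1 + ζ ^ 2 := by
  have h2 : (2 : F4) = 0 := CharTwo.two_eq_zero
  have h : a * (a - 1) * ((a - ζ ^ 2) * (a - (1 + ζ ^ 2))) = 0 := by
    linear_combination F4.pow_four a + (a ^ 2 - a) * (ζ ^ 2 - ζ + 1) * hζ
      + (-a ^ 3 * (1 + ζ ^ 2) + ζ ^ 2 * a ^ 2 + a) * h2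
  simpa [sub_eq_zero, or_assoc] using h

/-! ### Conjugation on `W`, the element `α` and its commutators -/

theorem conj_teich (a : F4) : conj (teich a) = teich a ^ 2 := by
  rw [← map_pow]
  ext n
  rw [conj, WittVector.coeff_frobenius_charP]
  rcases n with _ | n
  · simp [teich, WittVector.teichmuller_coeff_zero, -map_pow]
  · simp [teich, WittVector.teichmuller_coeff_pos, -map_pow]

theorem teich_sq_add_self_add_one {ζ : F4} (hζ : ζ ^ 2 + ζ + 1 = 0) :
    teich ζ ^ 2 + teich ζ + 1 = 0 := by
  have h3 : ζ ^ 3 = 1 := by linear_combination (ζ - 1) * hζ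
  have h1 : teich ζ - 1 ≠ 0 := by
    intro h
    have h := congrArg WittVector.constantCoeff h
    rw [map_sub, constantCoeff_teich, map_one, map_zero, sub_eq_zero] at h
    subst h
    have h2 : (2 : F4) = 0 := CharTwo.two_eq_zero
    exact one_ne_zero (α := F4) (by linear_combination hζ - h2)
  have h4 : teich ζ ^ 3 = 1 := by rw [← map_pow, h3, map_one]
  exact mul_left_cancel₀ h1 (by linear_combination h4)

theorem conj_ofPadicInt (r : ℤ_[2]) : conj (ofPadicInt r) = ofPadicInt r := by
  ext n
  rw [conj, WittVector.coeff_frobenius_charP]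
  simp only [ofPadicInt, RingHom.comp_apply, WittVector.map_coeff]
  rw [← map_pow, ZMod.pow_card]

/-- The element `α` of `W`, with the relations that determine what is needed of it. -/
theorem exists_alpha_eq (ζ : F4) : ∃ r s : W, r ^ 2 = -7 ∧ r * s = 1 ∧ conj s = s ∧
    (alpha ζ : EndRing) = ofW ((1 - 2 * teich ζ) * s) := by
  set u := Units.map (ofPadicInt : ℤ_[2] →* W) isUnit_sqrtNegSeven.unit
  have hu : (u : W) = ofPadicInt sqrtNegSeven := rfl
  have huu : (u : W) * (↑u⁻¹ : W) = 1 := u.mul_inv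
  refine ⟨u, ↑u⁻¹, ?_, huu, ?_, rfl⟩
  · rw [hu, ← map_pow, sqrtNegSeven_spec.1, map_neg, map_ofNat]
  · have h := congrArg conj huu
    rw [map_mul, map_one, hu, conj_ofPadicInt, ← hu] at h
    exact u.isUnit.mul_left_cancel (h.trans huu.symm)

theorem constantCoeff_eq_one_of_sq {r s : W} (h : r ^ 2 = -7) (hs : r * s = 1) :
    WittVector.constantCoeff s = 1 := by
  have h1 := congrArg WittVector.constantCoeff h
  have h2 := congrArg WittVector.constantCoeff hs
  rw [map_pow, map_neg, map_ofNat] at h1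
  rw [map_mul, map_one] at h2
  have h3 : (2 : F4) = 0 := CharTwo.two_eq_zero
  -- Modulo `2` one has `r ^ 2 = 1`, hence `s ^ 2 = 1`, and squaring is additive.
  have h4 : (WittVector.constantCoeff s - 1) ^ 2 = 0 := by
    linear_combination -WittVector.constantCoeff s ^ 2 * h1
      + (WittVector.constantCoeff r * WittVector.constantCoeff s + 1) * h2
      + (4 * WittVector.constantCoeff s ^ 2 - WittVector.constantCoeff s + 1) * h3
  exact sub_eq_zero.1 (pow_eq_zero_iff two_ne_zero |>.1 h4)

theorem residue_alpha (ζ : F4) : residue (alpha ζ : EndRing) = 1 := by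
  obtain ⟨r, s, hr, hs, -, h⟩ := exists_alpha_eq ζ
  rw [h, residue_ofW, map_mul, map_sub, map_mul, constantCoeff_two, map_one,
    constantCoeff_eq_one_of_sq hr hs]
  ring

/-- From `ζ ^ 2 = -ζ - 1` follows `(1 - 2 ζ) ^ 2 = -3 - 8 ζ = -7 + 4 (1 - 2 ζ)`, which is then
divided by `-7`. -/
theorem hasLead_alpha_sq {ζ : F4} (hζ : ζ ^ 2 + ζ + 1 = 0) : HasLead 4 1 (alpha ζ ^ 2) := by
  obtain ⟨r, s, hr, hs, -, h⟩ := exists_alpha_eq ζ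
  have hz := teich_sq_add_self_add_one hζ
  refine ⟨ofW ((1 - 2 * teich ζ) * s ^ 2), ?_, ?_⟩
  · rw [Units.val_pow_eq_pow_val, h, T_pow_two_mul 2, ← map_one ofW, ← map_pow, ← map_mul,
      ← map_add]
    congr 1
    linear_combination 4 * s ^ 2 * hz - s ^ 2 * hr + (r * s + 1) * hs
  · rw [residue_ofW, map_mul, map_sub, map_mul, constantCoeff_two, map_one, map_pow,
      constantCoeff_eq_one_of_sq hr hs]
    ring

/-- The norm of `1 - 2 ζ` is `7`, while `√-7` is fixed by conjugation and contributes its square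
`-7`. So `α ^ 2` has determinant `1`. -/
theorem det_alpha {ζ : F4} (hζ : ζ ^ 2 + ζ + 1 = 0) : det (alpha ζ : EndRing) = -1 := by
  obtain ⟨r, s, hr, hs, hc, h⟩ := exists_alpha_eq ζ
  have hz := teich_sq_add_self_add_one hζ
  have hd : ∀ a, det (ofW a) = a * conj a := fun a => by simp [det_apply, ofW]
  rw [h, hd, map_mul, map_sub, map_one, map_mul, conj_two, hc, conj_teich]
  linear_combination s ^ 2 * (4 * teich ζ - 6) * hz - (r * s + 1) * hs + s ^ 2 * hr

/-- For `g = x + y T` only `y T` fails to commute with `α`, and `g α - α g = y (conj α - α) T`. Here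
`conj α - α = 2 u` with `u` reducing to `ζ - ζ ^ 2 = 1`, and `2 = -T ^ 2` raises the level to 3. -/
theorem hasLead_commutator_alpha {ζ : F4} (hζ : ζ ^ 2 + ζ + 1 = 0) {g : S}
    (hg : residue (g : EndRing) = 1) :
    HasLead 3 (WittVector.constantCoeff (g : EndRing).y) ⁅g, alpha ζ⁆ := by
  have hα := residue_alpha ζ
  obtain ⟨r, s, hr, hs, hc, h⟩ := exists_alpha_eq ζ
  have hs1 := constantCoeff_eq_one_of_sq hr hs
  have hz := teich_sq_add_self_add_one hζ
  set α := alpha ζ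
  set u := (teich ζ - teich ζ ^ 2) * s with hu
  have hinv : ∀ k : S, residue (k : EndRing) = 1 → residue (↑k⁻¹ : EndRing) = 1 := by
    intro k hk
    have := congrArg residue k.mul_inv
    rwa [map_mul, hk, one_mul, map_one] at this
  -- Right multiplication by `(α g)⁻¹`, which is `1` modulo `T`, turns the additive commutator into
  -- the group commutator without changing the leading coefficient.
  have hd : residue ((↑g⁻¹ : EndRing) * ↑α⁻¹ - 1) = 0 := by
    rw [map_sub, map_mul, hinv g hg, hinv α hα, map_one, one_mul, sub_self]
  obtain ⟨d, hd⟩ := mem_idealT_one hd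
  obtain ⟨e, he⟩ := exists_T_pow_mul 3 d
  have hcomm : (g : EndRing) * α = α * g - ofW ((g : EndRing).y * u) * T ^ 3 := by
    rw [pow_succ, T_pow_two_mul 1, ← mul_assoc, ← map_mul, h]
    ext1
    · simp [ofW, T, sub_eq_add_neg]
      ring
    · simp [ofW, T, sub_eq_add_neg, hc, conj_two, conj_teich, hu]
      ring
  refine ⟨-(ofW ((g : EndRing).y * u) * (1 + e * T)), ?_, ?_⟩
  · have h1 : ((⁅g, α⁆ : S) : EndRing) = (g : EndRing) * α * (↑g⁻¹ * ↑α⁻¹) := by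
      simp [commutatorElement_def, mul_assoc]
    have h2 : (α : EndRing) * g * (↑g⁻¹ * ↑α⁻¹) = 1 := by simp [mul_assoc]
    have h3 : T ^ 3 * ((↑g⁻¹ : EndRing) * ↑α⁻¹) = (1 + e * T) * T ^ 3 := by
      rw [eq_add_of_sub_eq hd, mul_add, pow_one, ← mul_assoc, he]
      noncomm_ring
    rw [h1, hcomm, sub_mul, h2, mul_assoc, h3]
    noncomm_ring
  · have h1 : WittVector.constantCoeff u = 1 := by
      have h2 : (2 : F4) = 0 := CharTwo.two_eq_zero
      rw [hu, map_mul, map_sub, map_pow, hs1, constantCoeff_teich]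
      linear_combination -hζ + ζ * h2
    rw [map_neg, map_mul, residue_ofW, map_mul, h1, CharTwo.neg_eq, map_add, map_mul, residue_T,
      map_one]
    ring

/-! ### The elements `i` and `j` modulo `T ^ 2` -/

theorem constantCoeff_wittSum (a : ℕ → F4) : WittVector.constantCoeff (wittSum a) = a 0 := by
  have h := wittSum_spec a 1
  rw [pow_one, two_dvd_iff, map_sub, sub_eq_zero] at h
  rw [h]
  simp only [Finset.range_one, Finset.sum_singleton, pow_zero, mul_one, constantCoeff_teich]

theorem residue_elemI (ζ : F4) : residue (elemI ζ : EndRing) = 1 := by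
  change WittVector.constantCoeff (wittSum fun k => digit (iSeries ζ) (2 * k)) = 1
  rw [constantCoeff_wittSum, digit_zero_iSeries]

theorem constantCoeff_elemI_y (ζ : F4) :
    WittVector.constantCoeff (elemI ζ : EndRing).y = 1 := by
  change WittVector.constantCoeff (wittSum fun k => digit (iSeries ζ) (2 * k + 1)) = 1
  rw [constantCoeff_wittSum, digit_one_iSeries]

theorem elemJ_eq (ζ : F4ˣ) : (elemJ ζ : EndRing) =
    ofW (teich ζ) * elemI ζ * ofW (teich ζ ^ 2) := by
  rw [map_pow]
  rfl

theorem residue_elemJ {ζ : F4ˣ} (hζ : (ζ : F4) ^ 2 + ζ + 1 = 0) :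
    residue (elemJ ζ : EndRing) = 1 := by
  rw [elemJ_eq, map_mul, map_mul, residue_ofW, residue_ofW, residue_elemI, map_pow,
    constantCoeff_teich]
  linear_combination ((ζ : F4) - 1) * hζ

/-- Moving `ω ^ 2` past `T` conjugates it, so the coefficient `1` of `i` becomes `ζ * (ζ ^ 2) ^ 2 =
ζ ^ 5 = ζ ^ 2`. -/
theorem constantCoeff_elemJ_y (ζ : F4ˣ) :
    WittVector.constantCoeff (elemJ ζ : EndRing).y = (ζ : F4) ^ 2 := by
  rw [elemJ_eq, mul_ofW]
  have h : (ofW (teich ζ) * (elemI ζ : EndRing)).y = teich ζ * (elemI ζ : EndRing).y := by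
    simp [ofW]
  rw [h, map_mul, map_mul, constantCoeff_conj, constantCoeff_elemI_y, map_pow, constantCoeff_teich]
  linear_combination (ζ : F4) * F4.pow_four (ζ : F4)

theorem det_commutator (g h : S) : det ((⁅g, h⁆ : S) : EndRing) = 1 := by
  have hi : ∀ k : S, det (k : EndRing) * det (↑k⁻¹ : EndRing) = 1 := fun k => by
    rw [← map_mul, k.mul_inv, map_one]
  rw [commutatorElement_def, Units.val_mul, Units.val_mul, Units.val_mul, map_mul, map_mul,
    map_mul]
  linear_combination hi g * det (h : EndRing) * det (↑h⁻¹ : EndRing) + hi h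

end

end Morava

open Morava in
open scoped commutatorElement in
theorem mainTheorem9 (ζ : F4ˣ) (hζ : Algebra.adjoin (ZMod 2) {(ζ : F4)} = ⊤) :
    (Subgroup.closure {alpha ζ ^ 2, ⁅elemI ζ, alpha ζ⁆, ⁅elemJ ζ, alpha ζ⁆}).topologicalClosure
      = F32' := by
  have hz := sq_add_self_add_one hζ
  have hα := hasLead_alpha_sq hz
  have hi := hasLead_commutator_alpha hz (residue_elemI ζ)
  have hj := hasLead_commutator_alpha hz (residue_elemJ hz)
  rw [constantCoeff_elemI_y] at hi
  rw [constantCoeff_elemJ_y] at hj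
  set H := Subgroup.closure {alpha ζ ^ 2, ⁅elemI ζ, alpha ζ⁆, ⁅elemJ ζ, alpha (ζ : F4)⁆} with hH
  have hαH : alpha ζ ^ 2 ∈ H := Subgroup.subset_closure (by simp)
  have hiH : ⁅elemI ζ, alpha (ζ : F4)⁆ ∈ H := Subgroup.subset_closure (by simp)
  have hjH : ⁅elemJ ζ, alpha (ζ : F4)⁆ ∈ H := Subgroup.subset_closure (by simp)
  refine topologicalClosure_eq_F32' ?_ (fun a => ?_) ⟨_, hαH, hα⟩
  · rw [hH, Subgroup.closure_le]
    rintro _ (rfl | rfl | rfl)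
    · refine (mem_F32' _).2 ⟨F_mono (by norm_num) hα.mem_F, ?_⟩
      rw [Units.val_pow_eq_pow_val, map_pow, det_alpha hz, neg_one_sq]
    · exact (mem_F32' _).2 ⟨hi.mem_F, det_commutator _ _⟩
    · exact (mem_F32' _).2 ⟨hj.mem_F, det_commutator _ _⟩
  -- The four coefficients at level 3 come from the identity, the two commutators and their product.
  · rcases F4.cases hz a with rfl | rfl | rfl | rfl
    · exact ⟨1, one_mem _, 0, by simp, by simp⟩
    · exact ⟨_, hiH, hi⟩
    · exact ⟨_, hjH, hj⟩
    · exact ⟨_, mul_mem hiH hjH, hi.mul (by norm_num) hj⟩
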